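/- Let $G$ be a finite set with a distinguished (dummy) element $\circ\in G$, and let $\mathcal S_{OL}=G^{|G|}$ be the set of ordered lists $S=(S_1,\dots,S_{|G|})$ of length $|G|$ with entries in $G$ (repetitions allowed). For $M\ge 0$ let $\mathcal G_{SS}(M)$ be the set of all functions $g:\mathcal S_{OL}\to[0,M]$ of the form $$g(S)=\sum_{i=1}^{|G|}\lambda_i\, g_i(\{S_j : j\le i\}),$$ where $\lambda_i\ge 0$ and each $g_i:2^G\to\mathbb R$ is a monotone submodular set function with $g_i(X\cup\{\circ\})=g_i(X)$ for every $X\subseteq G$. In the $(\mathcal S_{OL},\mathcal G_{SS}(M))$-bandit with $T$ rounds, an oblivious adversary fixes $g_1,\dots,g_T\in\mathcal G_{SS}(M)$ in advance; in each round $t=1,\dots,T$ a randomized algorithm plays a list $S_t\in\mathcal S_{OL}$, chosen using only its internal randomness and the rewards $g_1(S_1),\dots,g_{t-1}(S_{t-1})$ observed so far (and its own past actions), and then observes only the number $g_t(S_t)$. Its expected $(1-1/e)$-regret is $$\mathcal R_{1-1/e}(T)=\max_{S^*\in\mathcal S_{OL}}\mathbb E\Big[\sum_{t=1}^T\big((1-\tfrac1e)\,g_t(S^*)-g_t(S_t)\big)\Big].$$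 Then there are constants $C_M$ ($M\ge0$), where $C_M$ depends only on $M$, such that for every finite set $G$, every $\circ\in G$ and every horizon $T\ge 2$ there is a randomized algorithm (which may depend on $G$, $\circ$ and $T$, but not on $M$) with the following property: for every $M\ge 0$ and every choice of $g_1,\dots,g_T\in\mathcal G_{SS}(M)$, $$\mathcal R_{1-1/e}(T)\le C_M\,|G|^{10/3}\,T^{2/3}\log T .$$ -/

import Mathlib

open scoped BigOperators

/-- A randomized strategy for a repeated game with action set `A` and bandit feedback: a random
seed is drawn once from the probability measure `law`, and the action of round `t` (rounds are
numbered `0, 1, 2, …`) is a function of the seed and of the real numbers observed as rewards in the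
`t` earlier rounds. The earlier actions are not listed among the arguments because they are
themselves functions of the seed and of the earlier rewards. -/
structure BanditAlgorithm (A : Type) where
  /-- The space of random seeds. -/
  Seed : Type
  /-- The σ-algebra on the seeds. -/
  seedSpace : MeasurableSpace Seed
  /-- The distribution of the seed. -/
  law : MeasureTheory.Measure Seed
  /-- The seed distribution is a probability measure. -/
  law_prob : MeasureTheory.IsProbabilityMeasure law
  /-- The action of round `t`, given the seed and the rewards observed in rounds `0, …, t - 1`. -/
  play : (t : ℕ) → Seed → (Fin t → ℝ) → A
  /-- The action is jointly measurable in the seed and the observations (`A` being discrete). -/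
  measurableSet_play : ∀ (t : ℕ) (a : A),
    MeasurableSet {p : Seed × (Fin t → ℝ) | play t p.1 p.2 = a}

namespace BanditAlgorithm

variable {A : Type} (alg : BanditAlgorithm A)

instance : MeasurableSpace alg.Seed := alg.seedSpace

instance : MeasureTheory.IsProbabilityMeasure alg.law := alg.law_prob

/-- The rewards observed in rounds `0, …, t - 1` when the strategy plays with seed `ω` against the
sequence of reward functions `g`. -/
def feedback (g : ℕ → A → ℝ) (ω : alg.Seed) : (t : ℕ) → Fin t → ℝ
  | 0 => Fin.elim0
  | t + 1 => Fin.snoc (α := fun _ => ℝ) (feedback g ω t)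
      (g t (alg.play t ω (feedback g ω t)))

/-- The action chosen in round `t` with seed `ω` against the sequence of reward functions `g`. -/
def action (g : ℕ → A → ℝ) (ω : alg.Seed) (t : ℕ) : A :=
  alg.play t ω (alg.feedback g ω t)

/-- The expected `α`-regret after `T` rounds against the (oblivious) sequence of reward functions
`g`: the maximum over fixed actions `a` of `𝔼 [∑ t < T, (α * g t a - g t (a_t))]`, where `a_t` is
the action of the strategy in round `t`. -/
noncomputable def regret (α : ℝ) (g : ℕ → A → ℝ) (T : ℕ) : ℝ :=
  ⨆ a : A, ∫ ω, ∑ t ∈ Finset.range T, (α * g t a - g t (alg.action g ω t)) ∂alg.law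

end BanditAlgorithm

/-- The ordered lists of length `|G|` with entries in `G` (repetitions are allowed). -/
abbrev OrderedList (G : Type) [Fintype G] : Type := Fin (Fintype.card G) → G

/-- The set of the entries of the ordered list `S` up to and including position `i`. -/
def prefixSet {G : Type} [Fintype G] [DecidableEq G] (S : OrderedList G)
    (i : Fin (Fintype.card G)) : Finset G :=
  (Finset.Iic i).image S

/-- Submodularity of a set function on the subsets of a finite set. -/
def IsSubmodular {G : Type} [DecidableEq G] (h : Finset G → ℝ) : Prop :=
  ∀ X Y : Finset G, h (X ∪ Y) + h (X ∩ Y) ≤ h X + h Y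

/-- The sequential submodular reward functions with values in `[0, M]` over the ground set `G` with
dummy element `o`: the functions `g S = ∑ i, w i * h i {S j | j ≤ i}` with weights `w i ≥ 0` and
monotone submodular set functions `h i`, for each of which `o` has marginal gain `0`. -/
def sequentialSubmodularRewards {G : Type} [Fintype G] [DecidableEq G] (o : G) (M : ℝ) :
    Set (OrderedList G → ℝ) :=
  {g | (∀ S, g S ∈ Set.Icc 0 M) ∧
    ∃ (w : Fin (Fintype.card G) → ℝ) (h : Fin (Fintype.card G) → Finset G → ℝ),
      (∀ i, 0 ≤ w i) ∧ (∀ i, Monotone (h i)) ∧ (∀ i, IsSubmodular (h i)) ∧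
      (∀ i, ∀ X : Finset G, h i (X ∪ {o}) = h i X) ∧
      ∀ S, g S = ∑ i, w i * h i (prefixSet S i)}

/-!
A list is a choice of one element for each of the `n = |G|` positions, and a sequential submodular
reward is monotone submodular as a function of the set of pairs (position, element), the dummy
standing for an empty position. The algorithm runs exponential weights separately in each position
and plays a list `S` with independent entries drawn from these weights. The scores fed to the weights
are not estimates of the reward itself but of the gradient of a boosted, non-oblivious surrogate: with
small probability `γ` the algorithm masks `S` by the dummy outside a random set `B` of positions,
overwrites a uniformly random position with a uniformly random element, and credits the observed
reward, suitably scaled, to that pair.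

The set `B` contains each position independently with probability `z`, where `z ∈ [0, 1]` has density
proportional to `exp (z - 1)`. Integrating the derivative in `z` of `exp (z - 1)` times the expected
reward of the masked list, and bounding the gain of a comparator `Y` by submodularity, gives
`(1 - 1 / e) * g Y - g S ≤ ` the total weighted gain of replacing entries of `S` by entries of `Y`
(`sequentialSubmodularRewards.boosted_inequality`). Hence low linear regret in every position yields
low `(1 - 1 / e)`-regret.

The regret analysis is a potential argument. One round changes the log-sum-exp potential in
expectation by at most minus the `(1 - 1 / e)`-regret of the round plus `γ M + η n³ M² / γ`
(`drift_le`), and a general lemma turns such a drift into a regret bound for an algorithm with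
independent uniform seeds (`exists_banditAlgorithm_regret_le_of_drift`). The learning rate
`η = T ^ (-2/3)` and `γ = T ^ (-1/3)` do not involve `M`; the second-order bound needs
`η n² M / γ ≤ 1`, and when this fails, `T ≤ n² M T ^ (2/3)` and the bound `M T` on the regret suffices.
-/

/-! ### Marginal gains of sequential submodular rewards -/

section Submodular

variable {G : Type} [DecidableEq G]

theorem IsSubmodular.marginal_le {h : Finset G → ℝ} (hs : IsSubmodular h) {A P : Finset G}
    (hAP : A ⊆ P) (hm : Monotone h) (y : G) :
    h (insert y P) - h P ≤ h (insert y A) - h A := by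
  have h1 := hs P (insert y A)
  have h2 : P ∪ insert y A = insert y P := by
    ext a; simp only [Finset.mem_union, Finset.mem_insert]
    constructor
    · rintro (h | h | h)
      · exact Or.inr h
      · exact Or.inl h
      · exact Or.inr (hAP h)
    · tauto
  have h3 : h A ≤ h (P ∩ insert y A) :=
    hm (Finset.subset_inter hAP (Finset.subset_insert _ _))
  rw [h2] at h1
  linarith

theorem IsSubmodular.union_image_sub_le {ι : Type*} [DecidableEq ι] {h : Finset G → ℝ}
    (hs : IsSubmodular h) (hm : Monotone h) (P : Finset G) (y : ι → G) (J : Finset ι) :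
    h (P ∪ J.image y) - h P ≤ ∑ j ∈ J, (h (insert (y j) P) - h P) := by
  induction J using Finset.induction_on with
  | empty => simp
  | insert j J hj ih =>
    rw [Finset.sum_insert hj, Finset.image_insert, Finset.union_insert]
    have := hs.marginal_le (Finset.subset_union_left (s₁ := P) (s₂ := J.image y)) hm (y j)
    linarith

variable [Fintype G]

/-- Changing entry `j` affects only the prefixes that reach `j`, and there it adds the new entry to
the set of the other entries. -/
theorem prefixSet_update (S : OrderedList G) (i j : Fin (Fintype.card G)) (a : G) :
    prefixSet (Function.update S j a) i =
      if j ≤ i then insert a (((Finset.Iic i).erase j).image S) else prefixSet S i := by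
  unfold prefixSet
  split_ifs with hji
  · conv_lhs => rw [← Finset.insert_erase (Finset.mem_Iic.2 hji)]
    rw [Finset.image_insert, Function.update_self]
    congr 1
    exact Finset.image_congr fun k hk =>
      Function.update_of_ne (Finset.ne_of_mem_erase hk) _ _
  · refine Finset.image_congr fun k hk => Function.update_of_ne ?_ _ _
    rintro rfl
    exact hji (Finset.mem_Iic.1 hk)

/-- Submodularity of `g` in the positions: from any list `R`, the sum over the positions `j` of the
gain of playing `Y j` rather than the dummy at `j` is at least the gap `g Y - g R`. The entry `R j`
is overwritten in both terms, which by submodularity only enlarges the gain of `Y j`. -/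
theorem sequentialSubmodularRewards.sub_le_sum_update {o : G} {M : ℝ} {g : OrderedList G → ℝ}
    (hg : g ∈ sequentialSubmodularRewards o M) (R Y : OrderedList G) :
    g Y - g R ≤ ∑ j, (g (Function.update R j (Y j)) - g (Function.update R j o)) := by
  obtain ⟨-, w, h, hw, hm, hs, ho, hg⟩ := hg
  simp only [hg, ← Finset.sum_sub_distrib, ← mul_sub]
  rw [Finset.sum_comm]
  simp only [← Finset.mul_sum]
  refine Finset.sum_le_sum fun i _ => mul_le_mul_of_nonneg_left ?_ (hw i)
  have key : ∀ j, (if j ∈ Finset.Iic i then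
        h i (insert (Y j) (prefixSet R i)) - h i (prefixSet R i) else 0) ≤
      h i (prefixSet (Function.update R j (Y j)) i) -
        h i (prefixSet (Function.update R j o) i) := by
    intro j
    simp only [prefixSet_update, Finset.mem_Iic]
    split_ifs with hji
    · have h1 := ho i (((Finset.Iic i).erase j).image R)
      rw [Finset.union_comm, ← Finset.insert_eq] at h1
      rw [h1]
      exact (hs i).marginal_le (Finset.image_subset_image (Finset.erase_subset _ _)) (hm i) _
    · simp
  calc h i (prefixSet Y i) - h i (prefixSet R i)
      ≤ h i (prefixSet R i ∪ (Finset.Iic i).image Y) - h i (prefixSet R i) :=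
        sub_le_sub_right (hm i Finset.subset_union_right) _
    _ ≤ ∑ j ∈ Finset.Iic i, (h i (insert (Y j) (prefixSet R i)) - h i (prefixSet R i)) :=
        (hs i).union_image_sub_le (hm i) _ _ _
    _ = ∑ j, if j ∈ Finset.Iic i then
          h i (insert (Y j) (prefixSet R i)) - h i (prefixSet R i) else 0 := by
        rw [Finset.sum_ite_mem, Finset.univ_inter]
    _ ≤ _ := Finset.sum_le_sum fun j _ => key j

end Submodular

/-! ### Boosting weights on subsets -/

section SubsetWeights

variable {ι : Type*} [Fintype ι] [DecidableEq ι]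

/-- The probability that a random subset containing each element independently with probability
`z` equals `B`. -/
def bernoulliWeight (z : ℝ) (B : Finset ι) : ℝ := ∏ i, if i ∈ B then z else 1 - z

theorem sum_eq_sum_powerset_erase (F : Finset ι → ℝ) (j : ι) :
    ∑ B, F B = ∑ B ∈ (Finset.univ.erase j).powerset, (F B + F (insert j B)) := by
  rw [Finset.sum_add_distrib, ← Finset.sum_powerset_insert (Finset.notMem_erase _ _) F,
    Finset.insert_erase (Finset.mem_univ j), Finset.powerset_univ]

/-- The contribution of the factor at `j` to the derivative in `z` of the expectation of `φ`: pairing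
`B` with `insert j B` for `j ∉ B`, both sides are the expected marginal value of `j`. -/
theorem sum_bernoulliWeight_deriv (z : ℝ) (φ : Finset ι → ℝ) (j : ι) :
    ∑ B, (∏ i ∈ Finset.univ.erase j, if i ∈ B then z else 1 - z) *
        (if j ∈ B then 1 else -1) * φ B =
      ∑ B, bernoulliWeight z B * (φ (insert j B) - φ (B.erase j)) := by
  rw [sum_eq_sum_powerset_erase _ j, sum_eq_sum_powerset_erase _ j]
  refine Finset.sum_congr rfl fun B hB => ?_
  have hj : j ∉ B := fun h => (Finset.notMem_erase j _) (Finset.mem_powerset.1 hB h)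
  have h1 : (∏ i ∈ Finset.univ.erase j, if i ∈ insert j B then z else 1 - z) =
      ∏ i ∈ Finset.univ.erase j, if i ∈ B then z else 1 - z :=
    Finset.prod_congr rfl fun i hi => by simp [Finset.ne_of_mem_erase hi]
  have h2 : ∀ C : Finset ι, bernoulliWeight z C = (if j ∈ C then z else 1 - z) *
      ∏ i ∈ Finset.univ.erase j, if i ∈ C then z else 1 - z := fun C =>
    (Finset.mul_prod_erase _ _ (Finset.mem_univ j)).symm
  rw [h2, h2, h1]
  simp only [hj, Finset.mem_insert_self, if_true, if_false, Finset.erase_eq_of_notMem hj,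
    Finset.erase_insert hj, Finset.insert_idem]
  ring

theorem hasDerivAt_sum_bernoulliWeight (φ : Finset ι → ℝ) (z : ℝ) :
    HasDerivAt (fun z => ∑ B, bernoulliWeight z B * φ B)
      (∑ B, bernoulliWeight z B * ∑ j, (φ (insert j B) - φ (B.erase j))) z := by
  have h1 : ∀ B : Finset ι, HasDerivAt (fun z => bernoulliWeight z B * φ B)
      ((∑ j, (∏ i ∈ Finset.univ.erase j, if i ∈ B then z else 1 - z) •
        (if j ∈ B then (1 : ℝ) else -1)) * φ B) z := by
    intro B
    refine HasDerivAt.mul_const (HasDerivAt.fun_finsetProd fun i _ => ?_) _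
    split_ifs
    · exact hasDerivAt_id z
    · simpa using (hasDerivAt_id z).const_sub 1
  refine (HasDerivAt.fun_sum (u := Finset.univ) fun B _ => h1 B).congr_deriv ?_
  simp only [Finset.mul_sum, Finset.sum_mul, smul_eq_mul]
  rw [Finset.sum_comm]
  conv_rhs => rw [Finset.sum_comm]
  exact Finset.sum_congr rfl fun j _ => sum_bernoulliWeight_deriv z φ j

theorem continuous_bernoulliWeight (B : Finset ι) :
    Continuous fun z : ℝ => bernoulliWeight z B := by
  unfold bernoulliWeight
  refine continuous_finsetProd _ fun i _ => ?_
  split_ifs <;> fun_prop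

/-- The boosting weight of `B`: the `bernoulliWeight` averaged over `z ∈ [0, 1]` with density
`exp (z - 1)`. The total mass is `1 - 1 / e` (`sum_boostWeight`), so these are not normalised. -/
noncomputable def boostWeight (B : Finset ι) : ℝ :=
  ∫ z in (0 : ℝ)..1, Real.exp (z - 1) * bernoulliWeight z B

theorem boostWeight_nonneg (B : Finset ι) : 0 ≤ boostWeight B := by
  refine intervalIntegral.integral_nonneg zero_le_one fun z hz => ?_
  refine mul_nonneg (Real.exp_pos _).le (Finset.prod_nonneg fun i _ => ?_)
  split_ifs
  · exact hz.1
  · exact sub_nonneg.2 hz.2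

/-- The fundamental theorem of calculus for `exp (z - 1)` times the expectation of `φ` under
`bernoulliWeight z`. -/
theorem sum_boostWeight_mul (φ : Finset ι → ℝ) :
    ∑ B, boostWeight B * (∑ j, (φ (insert j B) - φ (B.erase j)) + φ B) =
      φ Finset.univ - Real.exp (-1) * φ ∅ := by
  have hd : ∀ z : ℝ, HasDerivAt
      (fun z => Real.exp (z - 1) * ∑ B, bernoulliWeight z B * φ B)
      (∑ B, Real.exp (z - 1) * bernoulliWeight z B *
        (∑ j, (φ (insert j B) - φ (B.erase j)) + φ B)) z := by
    intro z
    have he : HasDerivAt (fun z : ℝ => Real.exp (z - 1)) (Real.exp (z - 1)) z := by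
      simpa using ((hasDerivAt_id z).sub_const 1).exp
    refine (he.mul (hasDerivAt_sum_bernoulliWeight φ z)).congr_deriv ?_
    simp only [mul_add, Finset.sum_add_distrib, mul_assoc, ← Finset.mul_sum]
    ring
  have hc : ∀ B : Finset ι, Continuous fun z : ℝ => Real.exp (z - 1) * bernoulliWeight z B *
        (∑ j, (φ (insert j B) - φ (B.erase j)) + φ B) := fun B =>
    ((by fun_prop : Continuous fun z : ℝ => Real.exp (z - 1)).mul
      (continuous_bernoulliWeight B)).mul continuous_const
  have hi := intervalIntegral.integral_eq_sub_of_hasDerivAt (a := 0) (b := 1) (fun z _ => hd z)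
    ((continuous_finsetSum _ fun B _ => hc B).intervalIntegrable _ _)
  rw [intervalIntegral.integral_finsetSum fun B _ => (hc B).intervalIntegrable _ _] at hi
  simp only [intervalIntegral.integral_mul_const] at hi
  have h1 : ∑ B, bernoulliWeight 1 B * φ B = φ (Finset.univ : Finset ι) := by
    rw [Finset.sum_eq_single Finset.univ]
    · simp [bernoulliWeight]
    · intro B _ hB
      obtain ⟨i, hi⟩ : ∃ i, i ∉ B := by
        by_contra! h
        exact hB (Finset.eq_univ_iff_forall.2 h)
      rw [bernoulliWeight, Finset.prod_eq_zero (Finset.mem_univ i) (by simp [hi]), zero_mul]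
    · simp
  have h0 : ∑ B, bernoulliWeight 0 B * φ B = φ (∅ : Finset ι) := by
    rw [Finset.sum_eq_single ∅]
    · simp [bernoulliWeight]
    · intro B _ hB
      obtain ⟨i, hi⟩ := Finset.nonempty_iff_ne_empty.2 hB
      rw [bernoulliWeight, Finset.prod_eq_zero (Finset.mem_univ i) (by simp [hi]), zero_mul]
    · simp
  rw [h1, h0] at hi
  simpa [boostWeight] using hi

theorem sum_boostWeight : ∑ B : Finset ι, boostWeight B = 1 - 1 / Real.exp 1 := by
  have := sum_boostWeight_mul (fun _ : Finset ι => (1 : ℝ))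
  simpa [Real.exp_neg] using this

end SubsetWeights

/-- The source of the factor `1 - 1 / e`: with `S` masked by the dummy outside a random set `B` of
positions, the weighted total gain of replacing entries of `S` by entries of `Y` dominates
`(1 - 1 / e) * g Y - g S`. The marginal values of the entries of `S` themselves telescope by
`sum_boostWeight_mul`. -/
theorem sequentialSubmodularRewards.boosted_inequality {G : Type} [Fintype G] [DecidableEq G]
    {o : G} {M : ℝ} {g : OrderedList G → ℝ}
    (hg : g ∈ sequentialSubmodularRewards o M) (S Y : OrderedList G) :
    (1 - 1 / Real.exp 1) * g Y - g S ≤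
      ∑ B : Finset (Fin (Fintype.card G)), boostWeight B * ∑ j,
        (g (Function.update (B.piecewise S fun _ => o) j (Y j)) -
          g (Function.update (B.piecewise S fun _ => o) j (S j))) := by
  set φ : Finset (Fin (Fintype.card G)) → ℝ := fun B => g (B.piecewise S fun _ => o) with hφ
  have hid := sum_boostWeight_mul φ
  have hins : ∀ (B : Finset (Fin (Fintype.card G))) j,
      g (Function.update (B.piecewise S fun _ => o) j (S j)) = φ (insert j B) :=
    fun B j => by rw [hφ]; simp only [Finset.piecewise_insert]
  have her : ∀ (B : Finset (Fin (Fintype.card G))) j,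
      g (Function.update (B.piecewise S fun _ => o) j o) = φ (B.erase j) := by
    intro B j
    rw [hφ]
    congr 1
    ext i
    by_cases hij : i = j
    · subst hij; simp
    · simp [Finset.piecewise, hij]
  have h0 : 0 ≤ φ ∅ := (hg.1 _).1
  have hu : φ Finset.univ = g S := by simp [hφ]
  have hpt : ∀ B : Finset (Fin (Fintype.card G)),
      g Y - (∑ j, (φ (insert j B) - φ (B.erase j)) + φ B) ≤
      ∑ j, (g (Function.update (B.piecewise S fun _ => o) j (Y j)) -
          g (Function.update (B.piecewise S fun _ => o) j (S j))) := by
    intro B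
    have := sub_le_sum_update hg (B.piecewise S fun _ => o) Y
    simp only [her, Finset.sum_sub_distrib] at this
    simp only [hins, Finset.sum_sub_distrib]
    have e : φ B = g (B.piecewise S fun _ => o) := rfl
    linarith
  calc (1 - 1 / Real.exp 1) * g Y - g S
      ≤ (1 - 1 / Real.exp 1) * g Y - (φ Finset.univ - Real.exp (-1) * φ ∅) := by
        have := mul_nonneg (Real.exp_pos (-1)).le h0
        linarith
    _ = ∑ B, boostWeight B * (g Y - (∑ j, (φ (insert j B) - φ (B.erase j)) + φ B)) := by
        rw [← hid, ← sum_boostWeight (ι := Fin (Fintype.card G)), Finset.sum_mul,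
          ← Finset.sum_sub_distrib]
        exact Finset.sum_congr rfl fun B _ => by ring
    _ ≤ _ := Finset.sum_le_sum fun B _ =>
        mul_le_mul_of_nonneg_left (hpt B) (boostWeight_nonneg B)

/-! ### State-based strategies driven by uniform seeds -/

section Sampling

open MeasureTheory ProbabilityTheory

/-- A state-dependent probability distribution on the finite set `R` of outcomes, measurable in the
state. -/
structure SamplingKernel (σ R : Type) [MeasurableSpace σ] [Fintype R] where
  /-- The probability of an outcome in a given state. -/
  prob : σ → R → ℝ
  measurable_prob : ∀ r, Measurable fun s => prob s r
  prob_nonneg : ∀ s r, 0 ≤ prob s r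
  sum_prob : ∀ s, ∑ r, prob s r = 1

variable {σ R A : Type} [MeasurableSpace σ] [Fintype R]

/-- A single uniform seed simulates the kernel, jointly measurably in the state and the seed. -/
theorem SamplingKernel.exists_sampler [MeasurableSpace R] [DiscreteMeasurableSpace R] [Nonempty R]
    (q : SamplingKernel σ R) :
    ∃ f : σ → unitInterval → R, Measurable (Function.uncurry f) ∧
      ∀ (s : σ) (φ : R → ℝ), ∫ u, φ (f s u) = ∑ r, q.prob s r * φ r := by
  let κ : Kernel σ R :=
    ⟨fun s => ∑ r, ENNReal.ofReal (q.prob s r) • Measure.dirac r, by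
      refine Measure.measurable_of_measurable_coe _ fun B _ => ?_
      simp only [Measure.coe_finsetSum, Finset.sum_apply, Measure.smul_apply, smul_eq_mul]
      exact Finset.measurable_fun_sum _ fun r _ =>
        (q.measurable_prob r).ennreal_ofReal.mul_const _⟩
  have hκ : ∀ s, κ s = ∑ r, ENNReal.ofReal (q.prob s r) • Measure.dirac r := fun s => rfl
  have : IsMarkovKernel κ := ⟨fun s => ⟨by
    rw [hκ]
    simp only [Measure.coe_finsetSum, Finset.sum_apply, Measure.smul_apply, measure_univ,
      smul_eq_mul, mul_one]
    rw [← ENNReal.ofReal_sum_of_nonneg fun r _ => q.prob_nonneg s r, q.sum_prob,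
      ENNReal.ofReal_one]⟩⟩
  obtain ⟨f, hf, hfκ⟩ := κ.exists_measurable_map_eq_unitInterval
  refine ⟨f, hf, fun s φ => ?_⟩
  have hm : Measurable (f s) := hf.of_uncurry_left
  rw [← integral_map (φ := f s) (f := φ) hm.aemeasurable
    (Measurable.of_discrete (f := φ)).aestronglyMeasurable, hfκ, hκ,
    integral_finsetSum_measure fun r _ => ?_]
  · refine Finset.sum_congr rfl fun r _ => ?_
    rw [integral_smul_measure, integral_dirac, ENNReal.toReal_ofReal (q.prob_nonneg s r),
      smul_eq_mul]
  · exact Integrable.of_finite.smul_measure ENNReal.ofReal_ne_top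

/-- The law of independent uniform seeds in `[0, 1]`, one for each round. -/
noncomputable abbrev seedLaw : Measure (ℕ → unitInterval) :=
  Measure.infinitePi fun _ : ℕ => (volume : Measure unitInterval)

theorem Measurable.apply_of_discrete {Ω β : Type*} [MeasurableSpace Ω] [MeasurableSpace β]
    [MeasurableSpace R] [DiscreteMeasurableSpace R] {h : R → Ω → β} {f : Ω → R}
    (hh : ∀ r, Measurable (h r)) (hf : Measurable f) : Measurable fun x => h (f x) x :=
  (measurable_from_prod_countable_left (f := fun p : Ω × R => h p.2 p.1) hh).comp
    (measurable_id.prodMk hf)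

/-- Each round has finitely many outcomes, so the state after `t` rounds takes finitely many values;
this gives integrability of every measurable function of it. -/
theorem finite_range_trajectory {σ R : Type} [Finite R] {f : σ → unitInterval → R} {s₀ : σ}
    {step : ℕ → σ → R → σ} {X : ℕ → (ℕ → unitInterval) → σ} (h0 : ∀ ω, X 0 ω = s₀)
    (hX : ∀ t ω, X (t + 1) ω = step t (X t ω) (f (X t ω) (ω t))) (t : ℕ) :
    (Set.range (X t)).Finite := by
  induction t with
  | zero => exact (Set.finite_singleton s₀).subset (by rintro _ ⟨ω, rfl⟩; exact h0 ω)
  | succ t ih =>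
    refine (Set.Finite.image2 (step t) ih (Set.finite_univ (α := R))).subset ?_
    rintro _ ⟨ω, rfl⟩
    exact ⟨X t ω, ⟨ω, rfl⟩, f (X t ω) (ω t), trivial, (hX t ω).symm⟩

section Trajectory

variable [MeasurableSpace R] [DiscreteMeasurableSpace R]
  {f : σ → unitInterval → R} {s₀ : σ} {step : ℕ → σ → R → σ} {X : ℕ → (ℕ → unitInterval) → σ}

/-- The state before round `t` depends only on the seeds of the earlier rounds, hence is independent
of the seed of round `t`. -/
theorem exists_measurable_factor (hf : Measurable (Function.uncurry f))
    (hstep : ∀ t r, Measurable fun s => step t s r) (h0 : ∀ ω, X 0 ω = s₀)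
    (hX : ∀ t ω, X (t + 1) ω = step t (X t ω) (f (X t ω) (ω t))) (t : ℕ) :
    ∃ F : (Finset.range t → unitInterval) → σ, Measurable F ∧
      ∀ ω : ℕ → unitInterval, X t ω = F fun i => ω i := by
  induction t with
  | zero => exact ⟨fun _ => s₀, measurable_const, h0⟩
  | succ t ih =>
    obtain ⟨F, hF, hXF⟩ := ih
    have hsub : ∀ i : Finset.range t, (i : ℕ) ∈ Finset.range (t + 1) := fun i =>
      Finset.mem_range.2 ((Finset.mem_range.1 i.2).trans t.lt_succ_self)
    let pre : (Finset.range (t + 1) → unitInterval) → Finset.range t → unitInterval :=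
      fun u i => u ⟨i, hsub i⟩
    have hpre : Measurable pre := measurable_pi_lambda _ fun i => measurable_pi_apply _
    have hlast : t ∈ Finset.range (t + 1) := Finset.self_mem_range_succ t
    refine ⟨fun u => step t (F (pre u)) (f (F (pre u)) (u ⟨t, hlast⟩)), ?_, fun ω => ?_⟩
    · refine Measurable.apply_of_discrete (h := fun r u => step t (F (pre u)) r)
        (fun r => (hstep t r).comp (hF.comp hpre)) ?_
      exact hf.comp ((hF.comp hpre).prodMk (measurable_pi_apply _))
    · rw [hX, hXF]

theorem Measurable.integrable_of_finite_range {Ω : Type*} [MeasurableSpace Ω] {μ : Measure Ω}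
    [IsFiniteMeasure μ] {Z : Ω → ℝ} (hZ : Measurable Z) (hfin : (Set.range Z).Finite) :
    Integrable Z μ := by
  obtain ⟨C, hC⟩ := (hfin.image fun x => ‖x‖).bddAbove
  exact Integrable.of_bound hZ.aestronglyMeasurable C
    (Filter.Eventually.of_forall fun x => hC ⟨Z x, ⟨x, rfl⟩, rfl⟩)

theorem integrable_trajectory (hf : Measurable (Function.uncurry f))
    (hstep : ∀ t r, Measurable fun s => step t s r) (h0 : ∀ ω, X 0 ω = s₀)
    (hX : ∀ t ω, X (t + 1) ω = step t (X t ω) (f (X t ω) (ω t))) (t : ℕ)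
    {φ : σ → R → ℝ} (hφ : ∀ r, Measurable fun s => φ s r) :
    Integrable (fun ω : ℕ → unitInterval => φ (X t ω) (f (X t ω) (ω t))) seedLaw := by
  obtain ⟨F, hF, hXF⟩ := exists_measurable_factor hf hstep h0 hX t
  have hXm : Measurable (X t) := by
    rw [funext hXF]
    exact hF.comp (measurable_pi_lambda _ fun i => measurable_pi_apply _)
  refine Measurable.integrable_of_finite_range ?_ ?_
  · exact Measurable.apply_of_discrete (h := fun r ω => φ (X t ω) r)
      (fun r => (hφ r).comp hXm) (hf.comp (hXm.prodMk (measurable_pi_apply t)))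
  · refine (Set.Finite.image2 φ (finite_range_trajectory h0 hX t)
      (Set.finite_univ (α := R))).subset ?_
    rintro _ ⟨ω, rfl⟩
    exact ⟨X t ω, ⟨ω, rfl⟩, f (X t ω) (ω t), trivial, rfl⟩

/-- Conditioning on the state: the outcome of round `t` may be averaged over the kernel. -/
theorem integral_trajectory (q : SamplingKernel σ R) (hf : Measurable (Function.uncurry f))
    (hfq : ∀ (s : σ) (φ : R → ℝ), ∫ u, φ (f s u) = ∑ r, q.prob s r * φ r)
    (hstep : ∀ t r, Measurable fun s => step t s r) (h0 : ∀ ω, X 0 ω = s₀)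
    (hX : ∀ t ω, X (t + 1) ω = step t (X t ω) (f (X t ω) (ω t))) (t : ℕ)
    {φ : σ → R → ℝ} (hφ : ∀ r, Measurable fun s => φ s r) :
    ∫ ω, φ (X t ω) (f (X t ω) (ω t)) ∂seedLaw =
      ∫ ω, ∑ r, q.prob (X t ω) r * φ (X t ω) r ∂seedLaw := by
  have hint := integrable_trajectory hf hstep h0 hX t hφ
  obtain ⟨F, hF, hXF⟩ := exists_measurable_factor hf hstep h0 hX t
  have hXm : Measurable (X t) := by
    rw [funext hXF]
    exact hF.comp (measurable_pi_lambda _ fun i => measurable_pi_apply _)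
  have hindep : IndepFun (X t) (fun ω : ℕ → unitInterval => ω t) seedLaw := by
    have h1 := (iIndepFun_infinitePi (P := fun _ : ℕ => (volume : Measure unitInterval))
      (X := fun _ u => u) fun _ => measurable_id).indepFun_finset (Finset.range t) {t}
      (by simp) fun i => measurable_pi_apply i
    have h2 := h1.comp hF
      (measurable_pi_apply (⟨t, Finset.mem_singleton_self t⟩ : ({t} : Finset ℕ)))
    rw [funext hXF]
    exact h2
  have hev : Measure.map (fun ω : ℕ → unitInterval => ω t) seedLaw = volume :=
    Measure.infinitePi_map_eval _ t
  have hmap : Measure.map (fun ω : ℕ → unitInterval => (X t ω, ω t)) seedLaw =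
      (Measure.map (X t) seedLaw).prod volume := by
    rw [(indepFun_iff_map_prod_eq_prod_map_map hXm.aemeasurable
      (measurable_pi_apply t).aemeasurable).1 hindep, hev]
  have hpair : Measurable fun ω : ℕ → unitInterval => (X t ω, ω t) :=
    hXm.prodMk (measurable_pi_apply t)
  have hΦ : Measurable fun p : σ × unitInterval => φ p.1 (f p.1 p.2) :=
    Measurable.apply_of_discrete (h := fun r (p : σ × unitInterval) => φ p.1 r)
      (fun r => (hφ r).comp measurable_fst) hf
  have hint' : Integrable (fun p : σ × unitInterval => φ p.1 (f p.1 p.2))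
      ((Measure.map (X t) seedLaw).prod volume) := by
    rw [← hmap, integrable_map_measure hΦ.aestronglyMeasurable hpair.aemeasurable]
    exact hint
  have : IsProbabilityMeasure (Measure.map (X t) seedLaw) :=
    Measure.isProbabilityMeasure_map hXm.aemeasurable
  calc ∫ ω, φ (X t ω) (f (X t ω) (ω t)) ∂seedLaw
      = ∫ p, φ p.1 (f p.1 p.2) ∂((Measure.map (X t) seedLaw).prod volume) := by
        rw [← hmap, integral_map hpair.aemeasurable hΦ.aestronglyMeasurable]
    _ = ∫ s, ∑ r, q.prob s r * φ s r ∂(Measure.map (X t) seedLaw) := by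
        rw [integral_prod _ hint']
        exact integral_congr_ae (Filter.Eventually.of_forall fun s => hfq s (φ s))
    _ = _ := integral_map hXm.aemeasurable (Finset.measurable_fun_sum _ fun r _ =>
        (q.measurable_prob r).mul (hφ r)).aestronglyMeasurable

end Trajectory

section Algorithm

/-- The state of the strategy after `t` rounds, rebuilt from the seeds and the observed rewards: in
each round an outcome is drawn by `f` from the current state and the seed of the round, and the state
is updated with the outcome and the reward. -/
def stateAfter (f : σ → unitInterval → R) (s₀ : σ) (upd : σ → R → ℝ → σ) (ω : ℕ → unitInterval) :
    (t : ℕ) → (Fin t → ℝ) → σ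
  | 0, _ => s₀
  | t + 1, obs =>
    let s := stateAfter f s₀ upd ω t (Fin.init obs)
    upd s (f s (ω t)) (obs (Fin.last t))

variable [MeasurableSpace R] [DiscreteMeasurableSpace R]

theorem measurable_stateAfter {f : σ → unitInterval → R} {s₀ : σ} {upd : σ → R → ℝ → σ}
    (hf : Measurable (Function.uncurry f))
    (hupd : ∀ r, Measurable fun p : σ × ℝ => upd p.1 r p.2) (t : ℕ) :
    Measurable fun p : (ℕ → unitInterval) × (Fin t → ℝ) => stateAfter f s₀ upd p.1 t p.2 := by
  induction t with
  | zero => exact measurable_const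
  | succ t ih =>
    have hinit : Measurable fun p : (ℕ → unitInterval) × (Fin (t + 1) → ℝ) =>
        (p.1, (Fin.init p.2 : Fin t → ℝ)) :=
      measurable_fst.prodMk (measurable_pi_lambda _ fun i =>
        (measurable_pi_apply _).comp measurable_snd)
    have hs := ih.comp hinit
    refine Measurable.apply_of_discrete
      (h := fun r (p : (ℕ → unitInterval) × (Fin (t + 1) → ℝ)) =>
        upd (stateAfter f s₀ upd p.1 t (Fin.init p.2)) r (p.2 (Fin.last t)))
      (fun r => (hupd r).comp (hs.prodMk ((measurable_pi_apply _).comp measurable_snd))) ?_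
    exact hf.comp (hs.prodMk ((measurable_pi_apply t).comp measurable_fst))

/-- The bandit algorithm that plays `act r` for the outcome `r` drawn from its current state. -/
noncomputable def statefulAlgorithm (f : σ → unitInterval → R)
    (hf : Measurable (Function.uncurry f)) (s₀ : σ) (upd : σ → R → ℝ → σ)
    (hupd : ∀ r, Measurable fun p : σ × ℝ => upd p.1 r p.2) (act : R → A) :
    BanditAlgorithm A where
  Seed := ℕ → unitInterval
  seedSpace := inferInstance
  law := seedLaw
  law_prob := inferInstance
  play t ω obs := act (f (stateAfter f s₀ upd ω t obs) (ω t))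
  measurableSet_play t a :=
    (hf.comp ((measurable_stateAfter hf hupd t).prodMk
      ((measurable_pi_apply t).comp measurable_fst))) (MeasurableSet.of_discrete (s := act ⁻¹' {a}))

end Algorithm

/-- The potential method: if for every comparator `a` one round, averaged over its outcome, pays for
its regret with a decrease of the nonnegative potential `Ψ a` up to the amount `c`, then the regret is
at most the initial potential plus `T * c`. The algorithm is chosen before the rewards, the horizon
and the potential. -/
theorem exists_banditAlgorithm_regret_le_of_drift (q : SamplingKernel σ R) (s₀ : σ)
    (upd : σ → R → ℝ → σ) (hupd : ∀ r, Measurable fun p : σ × ℝ => upd p.1 r p.2)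
    (act : R → A) :
    ∃ alg : BanditAlgorithm A, ∀ (g : ℕ → A → ℝ) (T : ℕ) (α b c : ℝ) (Ψ : A → σ → ℝ),
      (∀ a, Measurable (Ψ a)) → (∀ a s, 0 ≤ Ψ a s) → (∀ a, Ψ a s₀ ≤ b) →
      (∀ t < T, ∀ a s, ∑ r, q.prob s r *
        (α * g t a - g t (act r) + Ψ a (upd s r (g t (act r)))) ≤ Ψ a s + c) →
      alg.regret α g T ≤ b + T * c := by
  let _ : MeasurableSpace R := ⊤
  have : Nonempty R := by
    by_contra h
    rw [not_nonempty_iff] at h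
    simpa using q.sum_prob s₀
  obtain ⟨f, hf, hfq⟩ := q.exists_sampler
  refine ⟨statefulAlgorithm f hf s₀ upd hupd act, fun g T α b c Ψ hΨm hΨ hb hdrift => ?_⟩
  set alg := statefulAlgorithm f hf s₀ upd hupd act with halg
  have : Nonempty A := (‹Nonempty R›).map act
  refine ciSup_le fun a => ?_
  let X : ℕ → (ℕ → unitInterval) → σ := fun t ω =>
    stateAfter f s₀ upd ω t (alg.feedback g ω t)
  let step : ℕ → σ → R → σ := fun t s r => upd s r (g t (act r))
  have hstep : ∀ t r, Measurable fun s => step t s r := fun t r =>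
    (hupd r).comp (measurable_id.prodMk measurable_const)
  have h0 : ∀ ω, X 0 ω = s₀ := fun ω => rfl
  have hact : ∀ t (ω : ℕ → unitInterval), alg.action g ω t = act (f (X t ω) (ω t)) :=
    fun t ω => rfl
  have hX : ∀ t ω, X (t + 1) ω = step t (X t ω) (f (X t ω) (ω t)) := by
    intro t ω
    simp only [X, step, stateAfter, BanditAlgorithm.feedback, Fin.init_snoc, Fin.snoc_last]
    rfl
  have hΨint : ∀ t, Integrable (fun ω => Ψ a (X t ω)) seedLaw := fun t =>
    integrable_trajectory hf hstep h0 hX t (φ := fun s _ => Ψ a s) fun _ => hΨm a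
  have hrint : ∀ t, Integrable (fun ω => α * g t a - g t (act (f (X t ω) (ω t)))) seedLaw :=
    fun t => integrable_trajectory hf hstep h0 hX t
      (φ := fun _ r => α * g t a - g t (act r)) fun _ => measurable_const
  have hround : ∀ t < T, ∫ ω, (α * g t a - g t (act (f (X t ω) (ω t)))) ∂seedLaw +
      ∫ ω, Ψ a (X (t + 1) ω) ∂seedLaw ≤ ∫ ω, Ψ a (X t ω) ∂seedLaw + c := by
    intro t ht
    have hφ : ∀ r, Measurable fun s => α * g t a - g t (act r) + Ψ a (step t s r) := fun r =>
      measurable_const.add ((hΨm a).comp (hstep t r))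
    have hΨc : Integrable (fun ω => Ψ a (X t ω) + c) seedLaw :=
      (hΨint t).add (integrable_const c)
    have hsum : Integrable (fun ω => ∑ r, q.prob (X t ω) r *
        (α * g t a - g t (act r) + Ψ a (step t (X t ω) r))) seedLaw :=
      integrable_trajectory hf hstep h0 hX t (φ := fun s _ => ∑ r, q.prob s r *
        (α * g t a - g t (act r) + Ψ a (step t s r))) fun _ =>
        Finset.measurable_fun_sum _ fun r _ => (q.measurable_prob r).mul (hφ r)
    rw [← integral_add (hrint t) (hΨint (t + 1))]
    simp only [hX]
    rw [integral_trajectory q hf hfq hstep h0 hX t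
      (φ := fun s r => α * g t a - g t (act r) + Ψ a (step t s r)) hφ]
    refine (integral_mono hsum hΨc fun ω => hdrift t ht a (X t ω)).trans ?_
    rw [integral_add (hΨint t) (integrable_const c)]
    simp
  have htel : ∀ n ≤ T, ∑ t ∈ Finset.range n,
      ∫ ω, (α * g t a - g t (act (f (X t ω) (ω t)))) ∂seedLaw +
        ∫ ω, Ψ a (X n ω) ∂seedLaw ≤ Ψ a s₀ + n * c := by
    intro n
    induction n with
    | zero => intro _; simp [h0]
    | succ n ih =>
      intro hn
      have h1 := ih (Nat.le_of_succ_le hn)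
      have h2 := hround n hn
      rw [Finset.sum_range_succ]
      push_cast
      linarith
  calc ∫ ω, ∑ t ∈ Finset.range T, (α * g t a - g t (alg.action g ω t)) ∂alg.law
      = ∑ t ∈ Finset.range T,
          ∫ ω, (α * g t a - g t (act (f (X t ω) (ω t)))) ∂seedLaw :=
        integral_finsetSum _ fun t _ => hrint t
    _ ≤ b + T * c := by
        have h1 := htel T le_rfl
        have h2 : 0 ≤ ∫ ω, Ψ a (X T ω) ∂seedLaw := integral_nonneg fun ω => hΨ a _
        linarith [hb a]

end Sampling

/-! ### Exponential weights -/

section ExponentialWeights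

variable {G : Type} [Fintype G]

/-- The exponential weights with learning rate `η` for the scores `s`, normalised to sum to `1`. -/
noncomputable def softmax (η : ℝ) (s : G → ℝ) (a : G) : ℝ :=
  Real.exp (η * s a) / ∑ b, Real.exp (η * s b)

/-- The smooth maximum `log (∑ b, exp (η * s b)) / η` of the scores `s`. -/
noncomputable def smoothMax (η : ℝ) (s : G → ℝ) : ℝ :=
  Real.log (∑ b, Real.exp (η * s b)) / η

theorem sum_exp_pos [Nonempty G] (η : ℝ) (s : G → ℝ) : 0 < ∑ b, Real.exp (η * s b) :=
  Finset.sum_pos (fun _ _ => Real.exp_pos _) Finset.univ_nonempty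

theorem softmax_nonneg (η : ℝ) (s : G → ℝ) (a : G) : 0 ≤ softmax η s a :=
  div_nonneg (Real.exp_pos _).le (Finset.sum_nonneg fun _ _ => (Real.exp_pos _).le)

theorem sum_softmax [Nonempty G] (η : ℝ) (s : G → ℝ) : ∑ a, softmax η s a = 1 := by
  simp only [softmax]
  rw [← Finset.sum_div, div_self (sum_exp_pos η s).ne']

theorem le_smoothMax {η : ℝ} (hη : 0 < η) (s : G → ℝ) (a : G) : s a ≤ smoothMax η s := by
  have : Nonempty G := ⟨a⟩
  rw [smoothMax, le_div_iff₀ hη, Real.le_log_iff_exp_le (sum_exp_pos η s), mul_comm]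
  exact Finset.single_le_sum (f := fun b => Real.exp (η * s b)) (fun _ _ => (Real.exp_pos _).le)
    (Finset.mem_univ a)

theorem smoothMax_zero (η : ℝ) : smoothMax η (0 : G → ℝ) = Real.log (Fintype.card G) / η := by
  simp [smoothMax]

/-- Second-order bound for raising one score by `D`, from `exp u ≤ 1 + u + u ^ 2` for `u ≤ 1`. -/
theorem smoothMax_add_single_le [DecidableEq G] {η D : ℝ} (hη : 0 < η) (hD : 0 ≤ D)
    (hηD : η * D ≤ 1) (s : G → ℝ) (a : G) :
    smoothMax η (fun b => s b + if b = a then D else 0) ≤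
      smoothMax η s + softmax η s a * (D + η * D ^ 2) := by
  have : Nonempty G := ⟨a⟩
  set Z := ∑ b, Real.exp (η * s b) with hZ
  have hZpos : 0 < Z := sum_exp_pos η s
  have hsum : ∑ b, Real.exp (η * (s b + if b = a then D else 0)) =
      Z * (1 + softmax η s a * (Real.exp (η * D) - 1)) := by
    have h1 : ∀ b, Real.exp (η * (s b + if b = a then D else 0)) = Real.exp (η * s b) +
        if b = a then Real.exp (η * s b) * (Real.exp (η * D) - 1) else 0 := by
      intro b
      split_ifs
      · rw [mul_add, Real.exp_add]; ring
      · simp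
    simp only [h1, Finset.sum_add_distrib, Finset.sum_ite_eq', Finset.mem_univ, if_true]
    rw [softmax, ← hZ]
    field_simp
  have hexp : Real.exp (η * D) - 1 ≤ η * (D + η * D ^ 2) := by
    have h0 : 0 ≤ η * D := mul_nonneg hη.le hD
    have := (abs_le.1 (Real.abs_exp_sub_one_sub_id_le (x := η * D)
      (by rwa [abs_of_nonneg h0]))).2
    linarith
  have hexp0 : 0 ≤ Real.exp (η * D) - 1 := by
    have := Real.add_one_le_exp (η * D)
    linarith [mul_nonneg hη.le hD]
  have hp := softmax_nonneg η s a
  have hpos : 0 < 1 + softmax η s a * (Real.exp (η * D) - 1) := by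
    have := mul_nonneg hp hexp0
    linarith
  have hlog : Real.log (1 + softmax η s a * (Real.exp (η * D) - 1)) ≤
      softmax η s a * (η * (D + η * D ^ 2)) := by
    have h1 := Real.log_le_sub_one_of_pos hpos
    have h2 := mul_le_mul_of_nonneg_left hexp hp
    linarith
  rw [smoothMax, hsum, Real.log_mul hZpos.ne' hpos.ne', smoothMax, ← hZ, add_div]
  refine add_le_add le_rfl ?_
  rw [div_le_iff₀ hη]
  linarith

theorem measurable_smoothMax (η : ℝ) : Measurable fun s : G → ℝ => smoothMax η s := by
  unfold smoothMax
  fun_prop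

theorem measurable_softmax (η : ℝ) (a : G) : Measurable fun s : G → ℝ => softmax η s a := by
  unfold softmax
  fun_prop

end ExponentialWeights

/-! ### Product distributions on lists -/

section ProductDistribution

variable {ι G : Type} [Fintype ι] [DecidableEq ι] [Fintype G]

theorem sum_prod_apply_eq_one {x : ι → G → ℝ} (hx : ∀ j, ∑ a, x j a = 1) :
    ∑ S : ι → G, ∏ j, x j (S j) = 1 := by
  rw [← Fintype.prod_sum]
  simp [hx]

/-- Resampling the entry `j` of a list with independent entries does not change its law. -/
theorem sum_prod_mul_sum_update {x : ι → G → ℝ} (hx : ∀ j, ∑ a, x j a = 1) (j : ι)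
    (F : (ι → G) → ℝ) :
    ∑ S : ι → G, (∏ i, x i (S i)) * ∑ a, x j a * F (Function.update S j a) =
      ∑ S : ι → G, (∏ i, x i (S i)) * F S := by
  have hinv : Function.Involutive fun p : (ι → G) × G => (Function.update p.1 j p.2, p.1 j) := by
    rintro ⟨S, a⟩
    simp
  have hweight : ∀ (S : ι → G) (a : G), (∏ i, x i (Function.update S j a i)) * x j (S j) =
      (∏ i, x i (S i)) * x j a := by
    intro S a
    have h1 : ∏ i ∈ Finset.univ.erase j, x i (Function.update S j a i) =
        ∏ i ∈ Finset.univ.erase j, x i (S i) :=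
      Finset.prod_congr rfl fun i hi => by rw [Function.update_of_ne (Finset.ne_of_mem_erase hi)]
    rw [← Finset.mul_prod_erase _ _ (Finset.mem_univ j), h1,
      ← Finset.mul_prod_erase _ (fun i => x i (S i)) (Finset.mem_univ j), Function.update_self]
    ring
  calc ∑ S : ι → G, (∏ i, x i (S i)) * ∑ a, x j a * F (Function.update S j a)
      = ∑ p : (ι → G) × G, (∏ i, x i (p.1 i)) * x j p.2 * F (Function.update p.1 j p.2) := by
        rw [Fintype.sum_prod_type]
        simp only [Finset.mul_sum, mul_assoc]
    _ = ∑ p : (ι → G) × G, (∏ i, x i (p.1 i)) * x j p.2 * F p.1 := by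
        rw [← Equiv.sum_comp hinv.toPerm]
        refine Finset.sum_congr rfl fun p _ => ?_
        simp only [Function.Involutive.coe_toPerm, hweight, Function.update_idem,
          Function.update_eq_self]
    _ = ∑ S : ι → G, (∏ i, x i (S i)) * F S := by
        rw [Fintype.sum_prod_type]
        refine Finset.sum_congr rfl fun S _ => ?_
        dsimp only
        rw [← Finset.sum_mul, ← Finset.mul_sum, hx, mul_one]

end ProductDistribution

theorem sum_rotate {α β δ ε : Type*} [Fintype α] [Fintype β] [Fintype δ] [Fintype ε]
    (F : α → β → δ → ε → ℝ) :
    ∑ a, ∑ b, ∑ d, ∑ e, F a b d e = ∑ d, ∑ e, ∑ a, ∑ b, F a b d e := by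
  have h : ∀ a, ∑ b, ∑ d, ∑ e, F a b d e = ∑ d, ∑ e, ∑ b, F a b d e := fun a => by
    rw [Finset.sum_comm]
    exact Finset.sum_congr rfl fun d _ => Finset.sum_comm
  simp only [h]
  rw [Finset.sum_comm]
  exact Finset.sum_congr rfl fun d _ => Finset.sum_comm

/-! ### The exploring exponential-weights algorithm and its drift -/

section Drift

variable {G : Type} [Fintype G]

/-- The state of the algorithm: a cumulative score for each element in each position. -/
abbrev ScoreTable (G : Type) [Fintype G] : Type := Fin (Fintype.card G) → G → ℝ

/-- The random choices of one round: whether to explore, a position and an element to test, a set of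
positions to keep, and a list. -/
abbrev Draw (G : Type) [Fintype G] : Type :=
  Bool × Fin (Fintype.card G) × G × Finset (Fin (Fintype.card G)) × OrderedList G

/-- The probability of the list `S` when the entries are drawn independently, each position using
the exponential weights of its own scores. -/
noncomputable def listProb (η : ℝ) (s : ScoreTable G) (S : OrderedList G) : ℝ :=
  ∏ j, softmax η (s j) (S j)

theorem listProb_nonneg (η : ℝ) (s : ScoreTable G) (S : OrderedList G) : 0 ≤ listProb η s S :=
  Finset.prod_nonneg fun _ _ => softmax_nonneg _ _ _

theorem sum_listProb [Nonempty G] (η : ℝ) (s : ScoreTable G) : ∑ S, listProb η s S = 1 :=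
  sum_prod_apply_eq_one fun _ => sum_softmax _ _

theorem one_sub_inv_exp_pos : 0 < 1 - 1 / Real.exp 1 := by
  have h : 1 < Real.exp 1 := Real.one_lt_exp_iff.2 one_pos
  rw [sub_pos, div_lt_one (Real.exp_pos _)]
  exact h

theorem one_sub_inv_exp_le_one : 1 - 1 / Real.exp 1 ≤ 1 := by
  have := one_div_pos.2 (Real.exp_pos 1)
  linarith

/-- The joint probability of a tested position and element (uniform, so that the value depends on
neither), a kept set `B` (normalised `boostWeight`) and a list `S` (`listProb`). The list has as many
positions as `G` has elements, whence the square of `card G`. -/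
noncomputable def exploreProb (η : ℝ) (s : ScoreTable G) (B : Finset (Fin (Fintype.card G)))
    (S : OrderedList G) : ℝ :=
  (Fintype.card G : ℝ)⁻¹ * (Fintype.card G : ℝ)⁻¹ *
    (boostWeight B / (1 - 1 / Real.exp 1)) * listProb η s S

theorem exploreProb_nonneg (η : ℝ) (s : ScoreTable G) (B : Finset (Fin (Fintype.card G)))
    (S : OrderedList G) : 0 ≤ exploreProb η s B S := by
  have h1 := boostWeight_nonneg B
  have h2 := listProb_nonneg η s S
  have h3 := one_sub_inv_exp_pos
  unfold exploreProb
  positivity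

theorem sum_boostWeight_div [Nonempty G] :
    ∑ B : Finset (Fin (Fintype.card G)), boostWeight B / (1 - 1 / Real.exp 1) = 1 := by
  rw [← Finset.sum_div, sum_boostWeight, div_self one_sub_inv_exp_pos.ne']

theorem sum_exploreProb_mul [Nonempty G] (η : ℝ) (s : ScoreTable G)
    (φ : Fin (Fintype.card G) → G → ℝ) :
    ∑ j, ∑ a, ∑ B, ∑ S, exploreProb η s B S * φ j a =
      (Fintype.card G : ℝ)⁻¹ * (Fintype.card G : ℝ)⁻¹ * ∑ j, ∑ a, φ j a := by
  have h : ∑ B, ∑ S, exploreProb η s B S =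
      (Fintype.card G : ℝ)⁻¹ * (Fintype.card G : ℝ)⁻¹ := by
    simp only [exploreProb, ← Finset.mul_sum, sum_listProb, mul_one, sum_boostWeight_div]
  simp only [← Finset.sum_mul, h, ← Finset.mul_sum]

theorem sum_exploreProb_mul_list [Nonempty G] (η : ℝ) (s : ScoreTable G)
    (φ : OrderedList G → ℝ) :
    ∑ _j : Fin (Fintype.card G), ∑ _a : G, ∑ B, ∑ S, exploreProb η s B S * φ S =
      ∑ S, listProb η s S * φ S := by
  have hn : (Fintype.card G : ℝ) ≠ 0 := Nat.cast_ne_zero.2 Fintype.card_ne_zero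
  simp only [exploreProb, mul_assoc, ← Finset.mul_sum, ← Finset.sum_mul, sum_boostWeight_div,
    Finset.sum_const, Finset.card_univ, nsmul_eq_mul, Fintype.card_fin]
  field_simp

/-- The law of a round: explore with probability `γ`, independently of the other choices. -/
noncomputable def drawKernel [Nonempty G] (η γ : ℝ) (hγ : γ ∈ Set.Icc (0 : ℝ) 1) :
    SamplingKernel (ScoreTable G) (Draw G) where
  prob s r := (if r.1 then γ else 1 - γ) * exploreProb η s r.2.2.2.1 r.2.2.2.2
  measurable_prob r := by
    refine Measurable.const_mul (Measurable.const_mul ?_ _) _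
    exact Finset.measurable_fun_prod _ fun j _ =>
      (measurable_softmax η _).comp (measurable_pi_apply j)
  prob_nonneg s r := by
    refine mul_nonneg ?_ (exploreProb_nonneg _ _ _ _)
    split_ifs
    · exact hγ.1
    · exact sub_nonneg.2 hγ.2
  sum_prob s := by
    have h := sum_exploreProb_mul_list η s fun _ => 1
    simp only [mul_one, sum_listProb] at h
    simp only [Fintype.sum_prod_type, ← Finset.mul_sum, Fintype.sum_bool, h, if_true,
      Bool.false_eq_true, if_false]
    ring

theorem sum_drawKernel [Nonempty G] {η γ : ℝ} (hγ : γ ∈ Set.Icc (0 : ℝ) 1) (s : ScoreTable G)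
    (φ : Draw G → ℝ) :
    ∑ r, (drawKernel η γ hγ).prob s r * φ r =
      γ * ∑ j, ∑ a, ∑ B, ∑ S, exploreProb η s B S * φ (true, j, a, B, S) +
      (1 - γ) * ∑ j, ∑ a, ∑ B, ∑ S, exploreProb η s B S * φ (false, j, a, B, S) := by
  simp only [drawKernel, Fintype.sum_prod_type, Fintype.sum_bool, Finset.mul_sum, mul_assoc,
    if_true, Bool.false_eq_true, if_false]

/-- The list played to test `a` in position `j`: `S` masked by the dummy `o` outside `B`, with entry
`j` replaced by `a`. -/
def probeList (o : G) (j : Fin (Fintype.card G)) (a : G) (B : Finset (Fin (Fintype.card G)))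
    (S : OrderedList G) : OrderedList G :=
  Function.update (B.piecewise S fun _ => o) j a

theorem probeList_update (o : G) (j : Fin (Fintype.card G)) (a : G)
    (B : Finset (Fin (Fintype.card G))) (S : OrderedList G) :
    probeList o j a B (Function.update S j a) = probeList o j a B S := by
  ext i
  by_cases hij : i = j
  · subst hij; simp [probeList]
  · simp [probeList, Finset.piecewise, hij]

/-- The potential for the comparator list `Y`: the sum over the positions of the smooth maximum of
the scores minus the score of the entry of `Y`. -/
noncomputable def hedgePotential (η : ℝ) (Y : OrderedList G) (s : ScoreTable G) : ℝ :=
  ∑ j, (smoothMax η (s j) - s j (Y j))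

theorem measurable_hedgePotential (η : ℝ) (Y : OrderedList G) :
    Measurable (hedgePotential η Y) :=
  Finset.measurable_fun_sum _ fun j _ =>
    ((measurable_smoothMax η).comp (measurable_pi_apply j)).sub (by fun_prop)

theorem hedgePotential_nonneg {η : ℝ} (hη : 0 < η) (Y : OrderedList G) (s : ScoreTable G) :
    0 ≤ hedgePotential η Y s :=
  Finset.sum_nonneg fun _ _ => sub_nonneg.2 (le_smoothMax hη _ _)

theorem hedgePotential_zero (η : ℝ) (Y : OrderedList G) :
    hedgePotential η Y 0 = Fintype.card G * (Real.log (Fintype.card G) / η) := by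
  simp [hedgePotential, smoothMax_zero]

variable [DecidableEq G]

/-- The list played for given random choices: the test list when exploring, the drawn list
otherwise. -/
def drawnList (o : G) : Draw G → OrderedList G
  | (true, j, a, B, S) => probeList o j a B S
  | (false, _, _, _, S) => S

/-- Exploring rounds add `β` times the observed reward `v` to the tested score; the other rounds
leave the scores unchanged. -/
noncomputable def updateScores (β : ℝ) (s : ScoreTable G) : Draw G → ℝ → ScoreTable G
  | (true, j, a, _, _), v => fun i b => s i b + if i = j ∧ b = a then β * v else 0
  | (false, _, _, _, _), _ => s

theorem measurable_updateScores (β : ℝ) (r : Draw G) :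
    Measurable fun p : ScoreTable G × ℝ => updateScores β p.1 r p.2 := by
  obtain ⟨b, j, a, B, S⟩ := r
  cases b
  · exact measurable_fst
  · refine measurable_pi_lambda _ fun i => measurable_pi_lambda _ fun b => ?_
    simp only [updateScores]
    split_ifs <;> fun_prop

theorem hedgePotential_updateScores_le {η β v : ℝ} (hη : 0 < η) (hβv : 0 ≤ β * v)
    (hηβ : η * (β * v) ≤ 1) (Y : OrderedList G) (s : ScoreTable G) (j : Fin (Fintype.card G))
    (a : G) (B : Finset (Fin (Fintype.card G))) (S : OrderedList G) :
    hedgePotential η Y (updateScores β s (true, j, a, B, S) v) ≤ hedgePotential η Y s +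
      softmax η (s j) a * (β * v + η * (β * v) ^ 2) - if a = Y j then β * v else 0 := by
  have hterm : ∀ i, smoothMax η (updateScores β s (true, j, a, B, S) v i) -
      updateScores β s (true, j, a, B, S) v i (Y i) ≤ (smoothMax η (s i) - s i (Y i)) +
        if i = j then (softmax η (s j) a * (β * v + η * (β * v) ^ 2) -
          if a = Y j then β * v else 0) else 0 := by
    intro i
    by_cases hij : i = j
    · subst hij
      have h := smoothMax_add_single_le hη hβv hηβ (s i) a
      simp only [updateScores, true_and, if_true, eq_comm (a := Y i)]
      linarith
    · simp [updateScores, hij]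
  refine (Finset.sum_le_sum fun i _ => hterm i).trans (le_of_eq ?_)
  simp only [Finset.sum_add_distrib, Finset.sum_ite_eq', Finset.mem_univ, if_true, hedgePotential]
  ring

/-- `boosted_inequality` averaged over `S`: since the test list for `j` ignores `S j`, the element
drawn from the weights of position `j` may be taken to be `S j` itself. -/
theorem expected_estimate_le [Nonempty G] {o : G} {M : ℝ} {g : OrderedList G → ℝ}
    (hg : g ∈ sequentialSubmodularRewards o M) (η : ℝ) (s : ScoreTable G) (Y : OrderedList G) :
    ∑ B, boostWeight B * ∑ S, listProb η s S * ∑ j,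
        (∑ a, softmax η (s j) a * g (probeList o j a B S) - g (probeList o j (Y j) B S)) ≤
      ∑ S, listProb η s S * g S - (1 - 1 / Real.exp 1) * g Y := by
  have hres : ∀ B j, ∑ S, listProb η s S * ∑ a, softmax η (s j) a * g (probeList o j a B S) =
      ∑ S, listProb η s S * g (probeList o j (S j) B S) := by
    intro B j
    have h := sum_prod_mul_sum_update (fun i => sum_softmax η (s i)) j
      fun S : OrderedList G => g (probeList o j (S j) B S)
    simp only [Function.update_self, probeList_update] at h
    exact h
  calc _ = ∑ S, listProb η s S * ∑ B, boostWeight B * ∑ j,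
        (g (probeList o j (S j) B S) - g (probeList o j (Y j) B S)) := by
        have h1 : ∀ B, ∑ S, listProb η s S * ∑ j,
            (∑ a, softmax η (s j) a * g (probeList o j a B S) - g (probeList o j (Y j) B S)) =
            ∑ S, listProb η s S * ∑ j,
              (g (probeList o j (S j) B S) - g (probeList o j (Y j) B S)) := by
          intro B
          simp only [Finset.mul_sum (Finset.univ : Finset (Fin (Fintype.card G)))]
          rw [Finset.sum_comm]
          conv_rhs => rw [Finset.sum_comm]
          refine Finset.sum_congr rfl fun j _ => ?_
          simp only [mul_sub, Finset.sum_sub_distrib, hres]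
        simp only [h1]
        simp only [Finset.mul_sum (Finset.univ : Finset (OrderedList G)),
          Finset.mul_sum (Finset.univ : Finset (Finset (Fin (Fintype.card G))))]
        rw [Finset.sum_comm]
        exact Finset.sum_congr rfl fun S _ => Finset.sum_congr rfl fun B _ => by ring
    _ ≤ ∑ S, listProb η s S * (g S - (1 - 1 / Real.exp 1) * g Y) := by
        refine Finset.sum_le_sum fun S _ =>
          mul_le_mul_of_nonneg_left ?_ (listProb_nonneg η s S)
        have h := sequentialSubmodularRewards.boosted_inequality hg S Y
        have h2 : ∑ B : Finset (Fin (Fintype.card G)), boostWeight B * ∑ j,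
            (g (probeList o j (S j) B S) - g (probeList o j (Y j) B S)) =
            -∑ B : Finset (Fin (Fintype.card G)), boostWeight B * ∑ j,
            (g (probeList o j (Y j) B S) - g (probeList o j (S j) B S)) := by
          rw [← Finset.sum_neg_distrib]
          refine Finset.sum_congr rfl fun B _ => ?_
          simp only [Finset.sum_sub_distrib]
          ring
        rw [h2]
        simp only [probeList]
        linarith
    _ = _ := by
        simp only [mul_sub, Finset.sum_sub_distrib, ← Finset.sum_mul, sum_listProb, one_mul]

/-- The one-round drift. With `β = n ^ 2 * (1 - 1 / e) / γ` the expected first-order change of the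
potential is at most `E - (1 - 1 / e) * g Y`, where `E` is the expected reward of a drawn list; the
losses are the reward missed while exploring and the second-order term. -/
theorem drift_le [Nonempty G] {o : G} {M η γ β : ℝ} {g : OrderedList G → ℝ}
    (hg : g ∈ sequentialSubmodularRewards o M) (hη : 0 < η) (hγ0 : 0 < γ)
    (hγ : γ ∈ Set.Icc (0 : ℝ) 1)
    (hβ : β = (Fintype.card G : ℝ) ^ 2 * (1 - 1 / Real.exp 1) / γ) (hsmall : η * (β * M) ≤ 1)
    (Y : OrderedList G) (s : ScoreTable G) :
    ∑ r, (drawKernel η γ hγ).prob s r *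
        ((1 - 1 / Real.exp 1) * g Y - g (drawnList o r) +
          hedgePotential η Y (updateScores β s r (g (drawnList o r)))) ≤
      hedgePotential η Y s + (γ * M + η * (Fintype.card G : ℝ) ^ 3 * M ^ 2 / γ) := by
  set n : ℝ := (Fintype.card G : ℝ) with hn
  set κ : ℝ := 1 - 1 / Real.exp 1 with hκ
  have hκ0 : 0 < κ := one_sub_inv_exp_pos
  have hκ1 : κ ≤ 1 := one_sub_inv_exp_le_one
  have hn0 : 0 < n := by rw [hn]; exact_mod_cast Fintype.card_pos
  have hβ0 : 0 < β := by rw [hβ]; positivity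
  have hg0 : ∀ S, 0 ≤ g S := fun S => (hg.1 S).1
  have hgM : ∀ S, g S ≤ M := fun S => (hg.1 S).2
  set K : ℝ := κ * g Y + hedgePotential η Y s with hK
  -- Exploiting rounds leave the scores unchanged.
  have hexploit : ∑ j, ∑ a, ∑ B, ∑ S, exploreProb η s B S *
      (κ * g Y - g (drawnList o (false, j, a, B, S)) + hedgePotential η Y
        (updateScores β s (false, j, a, B, S) (g (drawnList o (false, j, a, B, S))))) =
      K - ∑ S, listProb η s S * g S := by
    simp only [drawnList, updateScores]
    rw [sum_exploreProb_mul_list η s fun S => κ * g Y - g S + hedgePotential η Y s]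
    simp only [mul_add, mul_sub, Finset.sum_add_distrib, Finset.sum_sub_distrib,
      ← Finset.sum_mul, sum_listProb, hK]
    ring
  have hexplore : ∑ j, ∑ a, ∑ B, ∑ S, exploreProb η s B S *
      (κ * g Y - g (drawnList o (true, j, a, B, S)) + hedgePotential η Y
        (updateScores β s (true, j, a, B, S) (g (drawnList o (true, j, a, B, S))))) ≤
      K + n⁻¹ * (η * (β * M) ^ 2) + γ⁻¹ * (∑ S, listProb η s S * g S - κ * g Y) := by
    calc _ ≤ ∑ j, ∑ a, ∑ B, ∑ S, (exploreProb η s B S *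
            (K + softmax η (s j) a * (η * (β * M) ^ 2)) + exploreProb η s B S *
            ((softmax η (s j) a - if a = Y j then 1 else 0) *
              (β * g (probeList o j a B S)))) := by
          refine Finset.sum_le_sum fun j _ => Finset.sum_le_sum fun a _ =>
            Finset.sum_le_sum fun B _ => Finset.sum_le_sum fun S _ => ?_
          rw [← mul_add]
          refine mul_le_mul_of_nonneg_left ?_ (exploreProb_nonneg η s B S)
          set v := g (drawnList o (true, j, a, B, S)) with hv
          have hv' : g (probeList o j a B S) = v := rfl
          have hv0 : 0 ≤ v := hg0 _
          have hβv : β * v ≤ β * M := mul_le_mul_of_nonneg_left (hgM _) hβ0.le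
          have h1 := hedgePotential_updateScores_le hη (mul_nonneg hβ0.le hv0)
            ((mul_le_mul_of_nonneg_left hβv hη.le).trans hsmall) Y s j a B S
          have h2 : softmax η (s j) a * (η * (β * v) ^ 2) ≤
              softmax η (s j) a * (η * (β * M) ^ 2) := by
            have := softmax_nonneg η (s j) a
            have := mul_nonneg hβ0.le hv0
            gcongr
          have h3 : (if a = Y j then β * v else 0) = (if a = Y j then 1 else 0) * (β * v) := by
            split_ifs <;> simp
          rw [h3] at h1
          rw [hv', hK]
          linarith
      _ = (K + n⁻¹ * (η * (β * M) ^ 2)) + γ⁻¹ * ∑ B, boostWeight B * ∑ S, listProb η s S *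
            ∑ j, (∑ a, softmax η (s j) a * g (probeList o j a B S) -
                g (probeList o j (Y j) B S)) := by
          simp only [Finset.sum_add_distrib]
          congr 1
          · rw [sum_exploreProb_mul η s fun j a => K + softmax η (s j) a * (η * (β * M) ^ 2)]
            simp only [Finset.sum_add_distrib, ← Finset.sum_mul, sum_softmax, Finset.sum_const,
              Finset.card_univ, nsmul_eq_mul, Fintype.card_fin, ← hn]
            field_simp
          · have hp : ∀ B S, exploreProb η s B S = boostWeight B * listProb η s S /
                (n ^ 2 * κ) := by
              intro B S
              rw [exploreProb, ← hn, ← hκ]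
              field_simp
            -- `β` cancels the uniform probability of `(j, a)` and the mass of `boostWeight`.
            have hβ' : ∀ j a B S, exploreProb η s B S *
                ((softmax η (s j) a - if a = Y j then 1 else 0) *
                  (β * g (probeList o j a B S))) = γ⁻¹ * (boostWeight B * (listProb η s S *
                ((softmax η (s j) a - if a = Y j then 1 else 0) *
                  g (probeList o j a B S)))) := by
              intro j a B S
              rw [hp, hβ]
              field_simp
            have hin : ∀ j B S, ∑ a, softmax η (s j) a * g (probeList o j a B S) -
                g (probeList o j (Y j) B S) = ∑ a, (softmax η (s j) a -
                  if a = Y j then 1 else 0) * g (probeList o j a B S) := by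
              intro j B S
              simp [sub_mul, Finset.sum_sub_distrib]
            simp only [hβ', hin, Finset.mul_sum]
            exact sum_rotate _
      _ ≤ _ := by
          have := expected_estimate_le hg η s Y
          have h2 := mul_le_mul_of_nonneg_left this (inv_pos.2 hγ0).le
          rw [← hκ] at h2
          linarith
  rw [sum_drawKernel, hexploit]
  have hE : ∑ S, listProb η s S * g S ≤ M := by
    calc ∑ S, listProb η s S * g S ≤ ∑ S, listProb η s S * M :=
          Finset.sum_le_sum fun S _ => mul_le_mul_of_nonneg_left (hgM S) (listProb_nonneg η s S)
      _ = M := by rw [← Finset.sum_mul, sum_listProb, one_mul]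
  set E := ∑ S, listProb η s S * g S with hEdef
  have hM0 : 0 ≤ M := (hg0 Y).trans (hgM Y)
  have hquad : γ * (n⁻¹ * (η * (β * M) ^ 2)) ≤ η * n ^ 3 * M ^ 2 / γ := by
    have h1 : γ * (n⁻¹ * (η * (β * M) ^ 2)) = κ ^ 2 * (η * n ^ 3 * M ^ 2 / γ) := by
      rw [hβ]; field_simp
    rw [h1]
    exact mul_le_of_le_one_left (by positivity) (pow_le_one₀ hκ0.le hκ1)
  have hmain := mul_le_mul_of_nonneg_left hexplore hγ0.le
  have hγγ : γ * (γ⁻¹ * (E - κ * g Y)) = E - κ * g Y := by field_simp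
  have hγE : γ * E ≤ γ * M := mul_le_mul_of_nonneg_left hE hγ0.le
  rw [mul_add, hγγ] at hmain
  calc _ ≤ γ * (K + n⁻¹ * (η * (β * M) ^ 2)) + (E - κ * g Y) + (1 - γ) * (K - E) :=
        add_le_add hmain le_rfl
    _ ≤ _ := by
        rw [hK]
        rw [hK] at hmain
        linarith

end Drift

/-! ### Regret bounds -/

/-- The algorithm does not depend on the bound `M`. The small-step condition of the second bound does,
and the first bound covers the horizons for which it fails. -/
theorem hedge_regret_le {G : Type} [Fintype G] [DecidableEq G] (o : G) {η γ : ℝ}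
    (hη : 0 < η) (hγ0 : 0 < γ) (hγ1 : γ ≤ 1) :
    ∃ alg : BanditAlgorithm (OrderedList G), ∀ (M : ℝ) (T : ℕ) (g : ℕ → OrderedList G → ℝ),
      (∀ t < T, g t ∈ sequentialSubmodularRewards o M) → 0 ≤ M →
        alg.regret (1 - 1 / Real.exp 1) g T ≤ T * M ∧
        (η * ((Fintype.card G : ℝ) ^ 2 / γ * M) ≤ 1 →
          alg.regret (1 - 1 / Real.exp 1) g T ≤
            Fintype.card G * (Real.log (Fintype.card G) / η) +
              T * (γ * M + η * (Fintype.card G : ℝ) ^ 3 * M ^ 2 / γ)) := by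
  have : Nonempty G := ⟨o⟩
  have hκ0 : 0 < 1 - 1 / Real.exp 1 := one_sub_inv_exp_pos
  have hκ1 : 1 - 1 / Real.exp 1 ≤ 1 := one_sub_inv_exp_le_one
  obtain ⟨alg, halg⟩ := exists_banditAlgorithm_regret_le_of_drift
    (drawKernel η γ ⟨hγ0.le, hγ1⟩) (0 : ScoreTable G)
    (updateScores ((Fintype.card G : ℝ) ^ 2 * (1 - 1 / Real.exp 1) / γ))
    (measurable_updateScores _) (drawnList o)
  refine ⟨alg, fun M T g hg hM => ⟨?_, fun hsmall => ?_⟩⟩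
  -- The zero potential gives the bound by the length of the game.
  · have h := halg g T (1 - 1 / Real.exp 1) 0 M (fun _ _ => 0) (fun _ => measurable_const)
      (fun _ _ => le_rfl) (fun _ => le_rfl) fun t ht Y s => ?_
    · simpa using h
    · have hpt : ∀ r, (1 - 1 / Real.exp 1) * g t Y - g t (drawnList o r) + 0 ≤ M := fun r => by
        have h1 := ((hg t ht).1 Y)
        have h2 := ((hg t ht).1 (drawnList o r)).1
        have h3 := mul_le_of_le_one_left h1.1 hκ1
        linarith [h1.2]
      calc _ ≤ ∑ r, (drawKernel η γ ⟨hγ0.le, hγ1⟩).prob s r * M :=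
            Finset.sum_le_sum fun r _ => mul_le_mul_of_nonneg_left (hpt r)
              ((drawKernel η γ ⟨hγ0.le, hγ1⟩).prob_nonneg s r)
        _ = 0 + M := by rw [← Finset.sum_mul, SamplingKernel.sum_prob, one_mul, zero_add]
  · refine halg g T _ _ _ (hedgePotential η) (measurable_hedgePotential η)
      (hedgePotential_nonneg hη) (fun Y => (hedgePotential_zero η Y).le) fun t ht Y s =>
        drift_le (hg t ht) hη hγ0 _ rfl (le_trans ?_ hsmall) Y s
    have h1 : (Fintype.card G : ℝ) ^ 2 * (1 - 1 / Real.exp 1) / γ ≤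
        (Fintype.card G : ℝ) ^ 2 / γ := by
      gcongr
      exact mul_le_of_le_one_right (by positivity) hκ1
    gcongr

theorem corollary5p6 :
    ∃ C : ℝ → ℝ, ∀ (G : Type) [Fintype G] [DecidableEq G] (o : G) (T : ℕ), 2 ≤ T →
      ∃ alg : BanditAlgorithm (OrderedList G),
        ∀ M : ℝ, 0 ≤ M → ∀ g : ℕ → OrderedList G → ℝ,
          (∀ t < T, g t ∈ sequentialSubmodularRewards o M) →
            alg.regret (1 - 1 / Real.exp 1) g T ≤
              C M * (Fintype.card G : ℝ) ^ (10 / 3 : ℝ) * (T : ℝ) ^ (2 / 3 : ℝ) *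
                Real.log T := by
  refine ⟨fun M => 2 * (1 + M + M ^ 2), fun G _ _ o T hT => ?_⟩
  have hT2 : (2 : ℝ) ≤ T := by exact_mod_cast hT
  have hT0 : (0 : ℝ) < T := by linarith
  set x : ℝ := (T : ℝ) ^ (1 / 3 : ℝ) with hx
  have hx1 : 1 ≤ x := Real.one_le_rpow (by linarith) (by norm_num)
  have hx0 : 0 < x := by linarith
  have hx3 : x ^ 3 = T := by
    rw [hx, ← Real.rpow_natCast, ← Real.rpow_mul hT0.le]; norm_num
  have hx2 : (T : ℝ) ^ (2 / 3 : ℝ) = x ^ 2 := by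
    rw [hx, ← Real.rpow_natCast, ← Real.rpow_mul hT0.le]; norm_num
  -- `η = T ^ (-2/3)` and `γ = T ^ (-1/3)` make every term of order `T ^ (2/3)` independently of `M`.
  obtain ⟨alg, halg⟩ := hedge_regret_le o (η := 1 / x ^ 2) (γ := 1 / x) (by positivity)
    (by positivity) ((div_le_one hx0).2 hx1)
  refine ⟨alg, fun M hM g hg => ?_⟩
  obtain ⟨htriv, hmain⟩ := halg M T g hg hM
  set n : ℝ := (Fintype.card G : ℝ) with hn
  have hn1 : 1 ≤ n := by
    have : Nonempty G := ⟨o⟩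
    rw [hn]
    exact_mod_cast Fintype.card_pos (α := G)
  have hpow : n ^ 3 ≤ n ^ (10 / 3 : ℝ) := by
    rw [← Real.rpow_natCast]
    exact Real.rpow_le_rpow_of_exponent_le hn1 (by norm_num)
  have hlogT : 1 ≤ 2 * Real.log T := by
    have h1 := Real.log_le_log (by norm_num) hT2
    have h2 := Real.log_two_gt_d9
    linarith
  have hpoly : alg.regret (1 - 1 / Real.exp 1) g T ≤ (1 + M + M ^ 2) * n ^ 3 * x ^ 2 := by
    by_cases hs : n ^ 2 * M ≤ x
    · refine (hmain ?_).trans ?_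
      · have : 1 / x ^ 2 * (n ^ 2 / (1 / x) * M) = n ^ 2 * M / x := by field_simp
        rw [this]
        exact (div_le_one hx0).2 hs
      · have hlog : Real.log n ≤ n := Real.log_le_self (by linarith)
        have e : n * (Real.log n / (1 / x ^ 2)) +
            T * (1 / x * M + 1 / x ^ 2 * n ^ 3 * M ^ 2 / (1 / x)) =
            (n * Real.log n + M + n ^ 3 * M ^ 2) * x ^ 2 := by
          rw [← hx3]; field_simp; ring
        rw [e]
        refine mul_le_mul_of_nonneg_right ?_ (by positivity)
        have h1 : n * Real.log n ≤ n ^ 3 := by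
          calc n * Real.log n ≤ n * n := by gcongr
            _ = n ^ 2 := by ring
            _ ≤ n ^ 3 := pow_le_pow_right₀ hn1 (by norm_num)
        have h2 : M ≤ M * n ^ 3 := le_mul_of_one_le_right hM (one_le_pow₀ hn1)
        linarith
    -- Here `T ^ (1/3) < n ^ 2 * M`, so that `T * M` is already small enough.
    · push Not at hs
      refine htriv.trans ?_
      calc T * M = x ^ 2 * M * x := by rw [← hx3]; ring
        _ ≤ x ^ 2 * M * (n ^ 2 * M) := by gcongr
        _ = M ^ 2 * n ^ 2 * x ^ 2 := by ring
        _ ≤ (1 + M + M ^ 2) * n ^ 3 * x ^ 2 := by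
          gcongr
          · linarith
          · norm_num
  rw [hx2]
  calc _ ≤ (1 + M + M ^ 2) * n ^ 3 * x ^ 2 * 1 := by rw [mul_one]; exact hpoly
    _ ≤ (1 + M + M ^ 2) * n ^ (10 / 3 : ℝ) * x ^ 2 * (2 * Real.log T) := by gcongr
    _ = _ := by ring
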